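/- Let $n\ge 0$ and $d\ge 1$ be integers, let $S=\mathbb C[x_0,\dots,x_n]$ with its standard grading and $\mathfrak m=(x_0,\dots,x_n)$. For a homogeneous polynomial $f\in S$ of degree $d$ let $J_f\subset S$ be the ideal generated by the partial derivatives of $f$, let $\widehat J_f=\{g\in S:\ \mathfrak m^k g\subset J_f\text{ for some }k\ge 0\}$ be its saturation, and put $M(f)=S/J_f$ and $N(f)=\widehat J_f/J_f$ (graded $S$-modules). For a graded $S$-module $M$ with finite-dimensional components write $HP(M)(t)=\sum_{k\ge 0}\dim_{\mathbb C} M_k\,t^k$. The singular points of $V(f)\subset\mathbb P^n$ are the points of $V(f)$ at which all partial derivatives of $f$ vanish; $V(f)$ has isolated singularities if there are finitely many of them, and is smooth if there are none. Suppose that $V(f)$ has only isolated singularities and that $\widehat J_f$ is a complete intersection ideal of multidegree $(d_1,\dots,d_n)$, i.e. it is generated by a regular sequence of $n$ homogeneous polynomials of degrees $d_1,\dots,d_n$. Let $f_s\in S$ be any homogeneous polynomial of degree $d$ such that $V(f_s)$ is smooth. Then $\sum_i d_i\le (n+1)(d-1)$, and $$HP(M(f_s))(t)-HP(N(f))(t)=P_{d_1}(t)\cdots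 P_{d_n}(t)\,P_{(n+1)(d-1)-\sum_i d_i}(t),\qquad P_m(t)=\frac{1-t^m}{1-t},$$ and this difference is a log-concave and unimodal polynomial. Here a real polynomial $\sum_{j=0}^m a_jt^j$ of degree $m$ (with $m=0$ for the zero polynomial) is log-concave if $a_k^2\ge a_{k-1}a_{k+1}$ for $1\le k\le m-1$, and unimodal if $a_0\le\dots\le a_i\ge\dots\ge a_m$ for some $0\le i\le m$. -/

import Mathlib

open scoped LinearAlgebra.Projectivization

noncomputable section

namespace MilnorLogConcave

/-- The graded polynomial ring `ℂ[x₀, …, xₙ]`. -/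
abbrev S (n : ℕ) : Type := MvPolynomial (Fin (n + 1)) ℂ

/-- The Jacobian ideal of `f`, generated by its first partial derivatives. -/
def jacobianIdeal {n : ℕ} (f : S n) : Ideal (S n) :=
  Ideal.span (Set.range fun i : Fin (n + 1) => MvPolynomial.pderiv i f)

/-- The homogeneous maximal ideal `(x₀, …, xₙ)`. -/
def irrelevantIdeal (n : ℕ) : Ideal (S n) :=
  Ideal.span (Set.range fun i : Fin (n + 1) => (MvPolynomial.X i : S n))

/-- The saturation of `I` with respect to `𝔪 = (x₀, …, xₙ)`: all `g` with `𝔪ᵏ g ⊆ I` for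
some `k`. -/
def saturation {n : ℕ} (I : Ideal (S n)) : Ideal (S n) where
  carrier := {g | ∃ k : ℕ, ∀ h ∈ irrelevantIdeal n ^ k, h * g ∈ I}
  zero_mem' := ⟨0, fun h _ => by simp⟩
  add_mem' := by
    rintro a b ⟨k, hk⟩ ⟨l, hl⟩
    refine ⟨k + l, fun h hh => ?_⟩
    rw [mul_add]
    exact I.add_mem (hk h (Ideal.pow_le_pow_right (Nat.le_add_right k l) hh))
      (hl h (Ideal.pow_le_pow_right (Nat.le_add_left l k) hh))
  smul_mem' := by
    rintro c a ⟨k, hk⟩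
    refine ⟨k, fun h hh => ?_⟩
    rw [smul_eq_mul, mul_left_comm]
    exact I.mul_mem_left c (hk h hh)

/-- The Milnor (Jacobian) algebra `M(f) = S / J_f`. -/
abbrev MilnorAlgebra {n : ℕ} (f : S n) : Type := S n ⧸ jacobianIdeal f

/-- The degree `k` component `M(f)_k`: the classes of the homogeneous polynomials of
degree `k`. -/
def milnorPiece {n : ℕ} (f : S n) (k : ℕ) : Submodule ℂ (MilnorAlgebra f) :=
  (MvPolynomial.homogeneousSubmodule (Fin (n + 1)) ℂ k).map
    (Ideal.Quotient.mkₐ ℂ (jacobianIdeal f)).toLinearMap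

/-- The module `N(f) = Ĵ_f / J_f`, as an ideal of `M(f)`, where `Ĵ_f` is the saturation of
the Jacobian ideal. -/
def localCohomologyModule {n : ℕ} (f : S n) : Ideal (MilnorAlgebra f) :=
  (saturation (jacobianIdeal f)).map (Ideal.Quotient.mk (jacobianIdeal f))

/-- The degree `k` component `N(f)_k = N(f) ∩ M(f)_k`. -/
def localCohomologyPiece {n : ℕ} (f : S n) (k : ℕ) : Submodule ℂ (MilnorAlgebra f) :=
  (localCohomologyModule f).restrictScalars ℂ ⊓ milnorPiece f k

/-- The Hilbert–Poincaré series `∑ₖ dim V_k tᵏ` of a family of subspaces `V_k` (the graded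
components of a graded module). -/
def hilbertPoincare {E : Type*} [AddCommGroup E] [Module ℂ E] (V : ℕ → Submodule ℂ E) :
    PowerSeries ℝ :=
  PowerSeries.mk fun k => (Module.finrank ℂ (V k) : ℝ)

/-- The set of singular points of the hypersurface `V(f) ⊆ ℙⁿ` defined by a homogeneous
polynomial `f`: the points of `V(f)` at which all the partial derivatives of `f` vanish.
(By homogeneity the choice of the representative of a point is irrelevant.) -/
def singularLocus {n : ℕ} (f : S n) : Set (ℙ ℂ (Fin (n + 1) → ℂ)) :=
  {p | MvPolynomial.eval p.rep f = 0 ∧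
    ∀ i : Fin (n + 1), MvPolynomial.eval p.rep (MvPolynomial.pderiv i f) = 0}

/-- `V(f)` has only isolated singularities; as the singular locus is Zariski closed, this
means that it is finite. -/
def HasIsolatedSingularities {n : ℕ} (f : S n) : Prop := (singularLocus f).Finite

/-- `V(f)` is a smooth hypersurface. -/
def IsSmoothHypersurface {n : ℕ} (f : S n) : Prop := singularLocus f = ∅

/-- `I` is a complete intersection ideal of multidegree `(e₁, …, e_r)`: it is generated by a
regular sequence of homogeneous polynomials of degrees `e₁, …, e_r`. -/
def IsCompleteIntersection {n r : ℕ} (I : Ideal (S n)) (e : Fin r → ℕ) : Prop :=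
  ∃ g : Fin r → S n, (∀ i, (g i).IsHomogeneous (e i)) ∧
    RingTheory.Sequence.IsRegular (S n) (List.ofFn g) ∧ I = Ideal.span (Set.range g)

/-- The sequence `a₀, …, a_m` is log-concave. -/
def LogConcaveSeq (a : ℕ → ℝ) (m : ℕ) : Prop :=
  ∀ k, 1 ≤ k → k + 1 ≤ m → a (k - 1) * a (k + 1) ≤ a k ^ 2

/-- The sequence `a₀, …, a_m` is unimodal. -/
def UnimodalSeq (a : ℕ → ℝ) (m : ℕ) : Prop :=
  ∃ i ≤ m, (∀ j < i, a j ≤ a (j + 1)) ∧ ∀ j, i ≤ j → j < m → a (j + 1) ≤ a j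

/-- A real polynomial is log-concave if its sequence of coefficients is. -/
def LogConcavePoly (P : Polynomial ℝ) : Prop := LogConcaveSeq P.coeff P.natDegree

/-- A real polynomial is unimodal if its sequence of coefficients is. -/
def UnimodalPoly (P : Polynomial ℝ) : Prop := UnimodalSeq P.coeff P.natDegree

/-- The polynomial `(1 - tᵐ) / (1 - t) = 1 + t + ⋯ + t^(m-1)`. -/
def geomPoly (m : ℕ) : Polynomial ℝ := ∑ i ∈ Finset.range m, Polynomial.X ^ i

end MilnorLogConcave

end

/-! Put D = d - 1, write H(-) for Hilbert series, and let J = J_f with saturation I = (g_1, ...,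
g_n). The heart is an elementary form of linkage. For nonzerodivisors a, b in an ideal A, modulo a
graded ideal P, one has b((P,a):A) + P = a((P,b):A) + P. So exchanging a for b changes the series of
((P,a):A)/(P,a) only by a power of t, and preserves its vanishing (`colonSeries_swap`,
`colon_sup_eq_of_swap`).

Exchanging the g_i one by one for general combinations of the partials (`exists_exchange`) gives a
complete intersection K inside J, generated by n forms of degree D. With A = I, where (I:I)/I = S/I,
this yields H((K:I)/K) = t^m H(S/I) with m = Dn - ∑ d_i. With A = 𝔪, it shows that K is saturated.
One further combination h gives J = K + (h), and saturation of K gives K:h = K:J = K:I. Hence H(S/J)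
= (1 - t^D) H(S/K) + t^(D+m) H(S/I) (`quotientSeries_of_saturation`).

For smooth f_s the same exchange, started from the variables, shows that the partials generate a
complete intersection ideal, so H(M(f_s)) = (1 - t^D) H(S/K). Since H(N(f)) = H(S/J) - H(S/I), the
difference is (1 - t^(D+m)) H(S/I), which is the stated product.

Log-concavity comes from a two-index inequality, stable under multiplication by each 1 + t + ⋯ +
t^(m-1), that is, under taking sums over m consecutive indices (`StronglyLogConcave.windowSum`).
Indexing by ℤ avoids boundary cases. -/

noncomputable section
namespace MilnorLogConcave

/-! ### Log-concavity and unimodality of products of geometric polynomials -/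

/-- A bi-infinite sequence is strongly log-concave if `a (i - 1) a (j + 1) ≤ a i a j` for all
`i ≤ j`. -/
def StronglyLogConcave (a : ℤ → ℝ) : Prop :=
  ∀ i j, i ≤ j → a (i - 1) * a (j + 1) ≤ a i * a j

theorem StronglyLogConcave.mul_le_mul_add {a : ℤ → ℝ} (ha : StronglyLogConcave a) (p s : ℤ)
    (x : ℕ) (hx : p + x ≤ s - x) : a p * a s ≤ a (p + x) * a (s - x) := by
  induction x with
  | zero => simp
  | succ x ih =>
    push_cast at hx
    refine (ih (by linarith)).trans ?_
    have h := ha (p + x + 1) (s - x - 1) (by linarith)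
    rw [show p + (x : ℤ) + 1 - 1 = p + x by ring, show s - (x : ℤ) - 1 + 1 = s - x by ring] at h
    push_cast
    rwa [← add_assoc, ← sub_sub]

theorem StronglyLogConcave.mul_le_mul {a : ℤ → ℝ} (ha : StronglyLogConcave a) {p q r s : ℤ}
    (hq : p ≤ q) (hr : p ≤ r) (h : p + s = q + r) : a p * a s ≤ a q * a r := by
  rcases le_total q r with hqr | hqr
  · have := ha.mul_le_mul_add p s (q - p).toNat (by omega)
    rwa [Int.toNat_of_nonneg (by omega), show p + (q - p) = q by ring,
      show s - (q - p) = r by linarith] at this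
  · have := ha.mul_le_mul_add p s (r - p).toNat (by omega)
    rwa [Int.toNat_of_nonneg (by omega), show p + (r - p) = r by ring,
      show s - (r - p) = q by linarith, mul_comm (a r)] at this

/-- The sums of `m` consecutive terms of a sequence. -/
def windowSum (m : ℕ) (a : ℤ → ℝ) (k : ℤ) : ℝ := ∑ l ∈ Finset.range m, a (k - l)

theorem windowSum_add_one (m : ℕ) (a : ℤ → ℝ) (k : ℤ) :
    windowSum m a (k + 1) = windowSum m a k + a (k + 1) - a (k + 1 - m) := by
  have h1 := Finset.sum_range_succ' (fun l : ℕ => a (k + 1 - l)) m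
  have h2 := Finset.sum_range_succ (fun l : ℕ => a (k + 1 - l)) m
  have h3 : ∑ l ∈ Finset.range m, a (k + 1 - ((l + 1 : ℕ) : ℤ)) = windowSum m a k :=
    Finset.sum_congr rfl fun l _ => by congr 1; push_cast; ring
  simp only [h3, Nat.cast_zero, sub_zero] at h1
  simp only [windowSum] at *
  linarith

/-- Write W for the window sums. Sliding the windows at j and i - 1 by one step turns W i * W j - W
(i-1) * W (j+1) into two differences, `e1` and `e2`. Each is nonnegative term by term, because the
pair with the same index sum moves inward. -/
theorem StronglyLogConcave.windowSum {a : ℤ → ℝ} (ha : StronglyLogConcave a) (m : ℕ) :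
    StronglyLogConcave (windowSum m a) := by
  intro i j hij
  have h1 := windowSum_add_one m a j
  have h2 := windowSum_add_one m a (i - 1)
  rw [sub_add_cancel] at h2
  have e1 : MilnorLogConcave.windowSum m a (i - 1) * a (j + 1) ≤
      MilnorLogConcave.windowSum m a j * a i := by
    simp only [MilnorLogConcave.windowSum, Finset.sum_mul]
    refine Finset.sum_le_sum fun l _ => ?_
    exact ha.mul_le_mul (by omega) (by omega) (by ring)
  have e2 : MilnorLogConcave.windowSum m a j * a (i - m) ≤
      MilnorLogConcave.windowSum m a (i - 1) * a (j + 1 - m) := by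
    simp only [MilnorLogConcave.windowSum, Finset.sum_mul]
    refine Finset.sum_le_sum fun l hl => ?_
    have := Finset.mem_range.mp hl
    rw [mul_comm]
    exact ha.mul_le_mul (by omega) (by omega) (by ring)
  rw [h1]
  have h3 : MilnorLogConcave.windowSum m a i =
    MilnorLogConcave.windowSum m a (i - 1) + a i - a (i - m) := h2
  rw [h3]
  nlinarith

/-- The coefficients of a polynomial, extended by zero to negative indices. -/
def coeffInt (P : Polynomial ℝ) (k : ℤ) : ℝ := if 0 ≤ k then P.coeff k.toNat else 0

theorem coeffInt_natCast (P : Polynomial ℝ) (k : ℕ) : coeffInt P k = P.coeff k := by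
  simp [coeffInt]

theorem coeffInt_mul_geomPoly (P : Polynomial ℝ) (m : ℕ) :
    coeffInt (P * geomPoly m) = windowSum m (coeffInt P) := by
  funext k
  simp only [coeffInt, windowSum, geomPoly, Finset.mul_sum, Polynomial.finsetSum_coeff,
    Polynomial.coeff_mul_X_pow']
  split_ifs with hk
  · refine Finset.sum_congr rfl fun l _ => ?_
    by_cases h : l ≤ k.toNat
    · rw [if_pos h, if_pos (by omega)]
      congr 1
      omega
    · rw [if_neg h, if_neg (by omega)]
  · symm
    refine Finset.sum_eq_zero fun l _ => if_neg (by omega)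

theorem coeffInt_nonneg_mul_geomPoly {P : Polynomial ℝ} (hP : ∀ k, 0 ≤ coeffInt P k) (m : ℕ)
    (k : ℤ) : 0 ≤ coeffInt (P * geomPoly m) k := by
  rw [coeffInt_mul_geomPoly]
  exact Finset.sum_nonneg fun _ _ => hP _

theorem stronglyLogConcave_one : StronglyLogConcave (coeffInt 1) := by
  intro i j hij
  simp only [coeffInt, Polynomial.coeff_one]
  split_ifs <;> simp <;> omega

theorem coeffInt_prod_geomPoly {ι : Type*} (s : Finset ι) (e : ι → ℕ) :
    StronglyLogConcave (coeffInt (∏ i ∈ s, geomPoly (e i))) ∧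
      ∀ k, 0 ≤ coeffInt (∏ i ∈ s, geomPoly (e i)) k := by
  classical
  induction s using Finset.induction_on with
  | empty =>
    refine ⟨by simpa using stronglyLogConcave_one, fun k => ?_⟩
    simp only [Finset.prod_empty, coeffInt, Polynomial.coeff_one]
    split_ifs <;> simp
  | insert i s hi ih =>
    rw [Finset.prod_insert hi, mul_comm]
    refine ⟨?_, coeffInt_nonneg_mul_geomPoly ih.2 _⟩
    rw [coeffInt_mul_geomPoly]
    exact ih.1.windowSum _

theorem StronglyLogConcave.logConcavePoly {P : Polynomial ℝ}
    (h : StronglyLogConcave (coeffInt P)) : LogConcavePoly P := by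
  intro k hk _
  have := h k k le_rfl
  rw [← Nat.cast_one, ← Nat.cast_sub hk, ← Nat.cast_add] at this
  simpa only [coeffInt_natCast, ← sq] using this

/-- The peak is an index of a largest coefficient. The two-index inequality compares any consecutive
pair directly with the pair next to the peak, so internal zeros cause no trouble. -/
theorem StronglyLogConcave.unimodalPoly {P : Polynomial ℝ}
    (h : StronglyLogConcave (coeffInt P)) (h0 : ∀ k, 0 ≤ coeffInt P k) : UnimodalPoly P := by
  have h0' : ∀ k, 0 ≤ P.coeff k := fun k => coeffInt_natCast P k ▸ h0 k
  have hmul : ∀ p q r s : ℕ, p ≤ q → p ≤ r → p + s = q + r →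
      P.coeff p * P.coeff s ≤ P.coeff q * P.coeff r := by
    intro p q r s hq hr hs
    simpa only [coeffInt_natCast] using
      h.mul_le_mul (p := p) (q := q) (r := r) (s := s) (by omega) (by omega) (by omega)
  obtain ⟨i, hi, hmax⟩ := Finset.exists_max_image (Finset.range (P.natDegree + 1)) P.coeff ⟨0, by simp⟩
  have hi' := Finset.mem_range.mp hi
  rcases (h0' i).eq_or_lt with hzero | hpos
  · have hz : ∀ j, P.coeff j = 0 := fun j => by
      by_cases hj : j < P.natDegree + 1
      · exact le_antisymm (hzero ▸ hmax j (Finset.mem_range.mpr hj)) (h0' j)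
      · exact Polynomial.coeff_eq_zero_of_natDegree_lt (by omega)
    exact ⟨i, by omega, by simp [hz], by simp [hz]⟩
  · refine ⟨i, by omega, fun j hj => ?_, fun j hij hj => ?_⟩
    -- a_j a_i ≤ a_(j+1) a_(i-1) ≤ a_(j+1) a_i, and a_i > 0 cancels.
    · have h1 := hmul j (j + 1) (i - 1) i (by omega) (by omega) (by omega)
      have h2 := hmax (i - 1) (Finset.mem_range.mpr (by omega))
      exact le_of_mul_le_mul_right (h1.trans (mul_le_mul_of_nonneg_left h2 (h0' _))) hpos
    · have h1 := hmul i j (i + 1) (j + 1) (by omega) (by omega) (by omega)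
      have h2 := hmax (i + 1) (Finset.mem_range.mpr (by omega))
      have h3 := h1.trans (mul_le_mul_of_nonneg_left h2 (h0' _))
      rw [mul_comm] at h3
      exact le_of_mul_le_mul_right h3 hpos

/-! ### Graded ideals and their Hilbert series -/

open MvPolynomial

attribute [local instance] MvPolynomial.gradedAlgebra

variable {n : ℕ}

/-- Homogeneous ideals for the standard grading. -/
abbrev IsGraded (I : Ideal (S n)) : Prop :=
  I.IsHomogeneous (homogeneousSubmodule (Fin (n + 1)) ℂ)

theorem isGraded_iff {I : Ideal (S n)} :
    IsGraded I ↔ ∀ x ∈ I, ∀ k, homogeneousComponent k x ∈ I := by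
  refine ⟨fun h x hx k => homogeneousComponent_mem_of_mem h hx k, fun h k x hx => ?_⟩
  have := h x hx k
  rwa [← decomposition.decompose'_apply] at this

theorem isGraded_span {s : Set (S n)} (h : ∀ x ∈ s, ∃ e, x.IsHomogeneous e) :
    IsGraded (Ideal.span s) :=
  Ideal.homogeneous_span _ _ h

theorem homogeneousComponent_add_mul {b : S n} {e : ℕ} (hb : b.IsHomogeneous e) (x : S n)
    (k : ℕ) : homogeneousComponent (e + k) (b * x) = b * homogeneousComponent k x := by
  have h := DirectSum.coe_decompose_mul_add_of_left_mem
    (homogeneousSubmodule (Fin (n + 1)) ℂ) (i := e) (j := k) (b := x)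
    ((mem_homogeneousSubmodule e b).mpr hb)
  have h1 := decomposition.decompose'_apply (R := ℂ) (b * x) (e + k)
  have h2 := decomposition.decompose'_apply (R := ℂ) x k
  rw [← h1, ← h2]
  exact h

theorem homogeneousComponent_mul_of_lt {b : S n} {e : ℕ} (hb : b.IsHomogeneous e) (x : S n)
    {k : ℕ} (hk : k < e) : homogeneousComponent k (b * x) = 0 := by
  have h := DirectSum.coe_decompose_mul_of_left_mem_of_not_le
    (homogeneousSubmodule (Fin (n + 1)) ℂ) (i := e) (n := k) (b := x)
    ((mem_homogeneousSubmodule e b).mpr hb) (by omega)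
  have h1 := decomposition.decompose'_apply (R := ℂ) (b * x) k
  rw [← h1]
  exact h

theorem IsGraded.colon_span {K : Ideal (S n)} (hK : IsGraded K) {s : Set (S n)}
    (hs : ∀ x ∈ s, ∃ e, x.IsHomogeneous e) :
    IsGraded (K.colon (Ideal.span s : Set (S n))) := by
  rw [isGraded_iff] at hK ⊢
  intro x hx k
  rw [Submodule.mem_colon] at hx ⊢
  intro y hy
  rw [smul_eq_mul]
  induction hy using Submodule.span_induction with
  | mem y hy =>
    obtain ⟨e, he⟩ := hs y hy
    rw [mul_comm, ← homogeneousComponent_add_mul he]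
    apply hK
    rw [mul_comm]
    exact hx y (Ideal.subset_span hy)
  | zero => simp
  | add y z _ _ h1 h2 => rw [mul_add]; exact K.add_mem h1 h2
  | smul a y _ h => rw [smul_eq_mul, mul_left_comm]; exact K.mul_mem_left a h

/-- The homogeneous elements of degree `k` of an ideal. -/
def degPart (I : Ideal (S n)) (k : ℕ) : Submodule ℂ (S n) :=
  I.restrictScalars ℂ ⊓ homogeneousSubmodule (Fin (n + 1)) ℂ k

theorem mem_degPart {I : Ideal (S n)} {k : ℕ} {x : S n} :
    x ∈ degPart I k ↔ x ∈ I ∧ x.IsHomogeneous k := Iff.rfl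

instance finiteDimensional_homogeneousSubmodule (k : ℕ) :
    FiniteDimensional ℂ (homogeneousSubmodule (Fin (n + 1)) ℂ k) :=
  Module.Finite.iff_fg.mpr (homogeneousSubmodule_fg _ _ k)

instance finiteDimensional_degPart (I : Ideal (S n)) (k : ℕ) :
    FiniteDimensional ℂ (degPart I k) :=
  Submodule.finiteDimensional_of_le inf_le_right

/-- The Hilbert series of an ideal. -/
abbrev idealSeries (I : Ideal (S n)) : PowerSeries ℝ := hilbertPoincare (degPart I)

theorem degPart_mul_sup_of_lt {P X : Ideal (S n)} (hP : IsGraded P) {b : S n} {e : ℕ}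
    (hb : b.IsHomogeneous e) {k : ℕ} (hk : k < e) :
    degPart (Ideal.span {b} * X ⊔ P) k = degPart P k := by
  refine le_antisymm (fun x hx => ?_) fun x hx =>
    ⟨(le_sup_right : P ≤ Ideal.span {b} * X ⊔ P) hx.1, hx.2⟩
  obtain ⟨hx, hxk⟩ := mem_degPart.mp hx
  obtain ⟨y, hy, p, hp, rfl⟩ := Submodule.mem_sup.mp hx
  obtain ⟨z, hz, rfl⟩ := Ideal.mem_span_singleton_mul.mp hy
  have h := homogeneousComponent_eq_self hxk
  rw [map_add, homogeneousComponent_mul_of_lt hb _ hk, zero_add] at h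
  exact ⟨h ▸ isGraded_iff.mp hP p hp k, hxk⟩

theorem degPart_mul_sup_add {P X : Ideal (S n)} (hP : IsGraded P) (hX : IsGraded X) {b : S n}
    {e : ℕ} (hb : b.IsHomogeneous e) (k : ℕ) :
    degPart (Ideal.span {b} * X ⊔ P) (e + k) =
      (degPart X k).map (LinearMap.mulLeft ℂ b) ⊔ degPart P (e + k) := by
  apply le_antisymm
  · intro x hx
    obtain ⟨hx, hxk⟩ := mem_degPart.mp hx
    obtain ⟨y, hy, p, hp, rfl⟩ := Submodule.mem_sup.mp hx
    obtain ⟨z, hz, rfl⟩ := Ideal.mem_span_singleton_mul.mp hy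
    have h := homogeneousComponent_eq_self hxk
    rw [map_add, homogeneousComponent_add_mul hb] at h
    rw [← h]
    refine Submodule.add_mem_sup (Submodule.mem_map.mpr ⟨homogeneousComponent k z, ?_, rfl⟩) ?_
    · exact ⟨isGraded_iff.mp hX z hz k, homogeneousComponent_isHomogeneous k z⟩
    · exact ⟨isGraded_iff.mp hP p hp _, homogeneousComponent_isHomogeneous _ p⟩
  · refine sup_le ?_ fun x hx => ⟨(le_sup_right : P ≤ Ideal.span {b} * X ⊔ P) hx.1, hx.2⟩
    rintro _ ⟨x, hx, rfl⟩
    exact ⟨(le_sup_left : _ ≤ Ideal.span {b} * X ⊔ P)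
      (Ideal.mem_span_singleton_mul.mpr ⟨x, hx.1, rfl⟩), hb.mul hx.2⟩

theorem map_mulLeft_inf_degPart {P X : Ideal (S n)} {b : S n} {e : ℕ} (hb : b.IsHomogeneous e)
    (k : ℕ) :
    (degPart X k).map (LinearMap.mulLeft ℂ b) ⊓ degPart P (e + k) =
      (degPart (X ⊓ P.colon {b}) k).map (LinearMap.mulLeft ℂ b) := by
  apply le_antisymm
  · rintro _ ⟨⟨x, hx, rfl⟩, hP⟩
    refine ⟨x, ⟨⟨hx.1, ?_⟩, hx.2⟩, rfl⟩
    rw [SetLike.mem_coe, Submodule.mem_colon_singleton, smul_eq_mul, mul_comm]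
    exact hP.1
  · rintro _ ⟨x, ⟨⟨hx, hP⟩, hxk⟩, rfl⟩
    refine ⟨⟨x, ⟨hx, hxk⟩, rfl⟩, ?_, hb.mul hxk⟩
    rw [SetLike.mem_coe, Submodule.mem_colon_singleton, smul_eq_mul, mul_comm] at hP
    exact hP

theorem finrank_map_mulLeft {b : S n} (hb : b ≠ 0) (V : Submodule ℂ (S n)) :
    Module.finrank ℂ (V.map (LinearMap.mulLeft ℂ b)) = Module.finrank ℂ V :=
  (Submodule.equivMapOfInjective _ (mul_right_injective₀ hb) V).finrank_eq.symm

theorem coeff_idealSeries (I : Ideal (S n)) (k : ℕ) :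
    PowerSeries.coeff k (idealSeries I) = Module.finrank ℂ (degPart I k) := by
  simp [idealSeries, hilbertPoincare]

/-- In degree e + k the ideal is the sum of b X_k and P_(e+k), which meet in b (X ∩ (P:b))_k; the
dimension formula for a sum of subspaces applies. Multiplication by b = 0 is not injective, but then
X ∩ (P:b) = X and the correction term vanishes. -/
theorem idealSeries_mul_sup {P X : Ideal (S n)} (hP : IsGraded P) (hX : IsGraded X) {b : S n}
    {e : ℕ} (hb : b.IsHomogeneous e) :
    idealSeries (Ideal.span {b} * X ⊔ P) =
      idealSeries P + PowerSeries.X ^ e * (idealSeries X - idealSeries (X ⊓ P.colon {b})) := by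
  rcases eq_or_ne b 0 with rfl | hb0
  · have h : X ⊓ P.colon {(0 : S n)} = X := inf_eq_left.mpr fun x _ => by
      rw [Submodule.mem_colon_singleton]; simp
    rw [h]
    simp
  · ext k
    rw [map_add, PowerSeries.coeff_X_pow_mul', map_sub]
    simp only [coeff_idealSeries]
    split_ifs with hk
    · obtain ⟨j, rfl⟩ := Nat.exists_eq_add_of_le hk
      have h := Submodule.finrank_sup_add_finrank_inf_eq
        ((degPart X j).map (LinearMap.mulLeft ℂ b)) (degPart P (e + j))
      rw [← degPart_mul_sup_add hP hX hb, map_mulLeft_inf_degPart hb, finrank_map_mulLeft hb0,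
        finrank_map_mulLeft hb0] at h
      rw [Nat.add_sub_cancel_left, add_sub_left_comm]
      have h' : (Module.finrank ℂ (degPart (Ideal.span {b} * X ⊔ P) (e + j)) : ℝ) +
        Module.finrank ℂ (degPart (X ⊓ P.colon {b}) j) =
        Module.finrank ℂ (degPart X j) + Module.finrank ℂ (degPart P (e + j)) := by
        exact_mod_cast h
      linarith
    · rw [degPart_mul_sup_of_lt hP hb (not_le.mp hk), add_zero]

/-- `b` is a nonzerodivisor modulo `P`. -/
def RegularMod (P : Ideal (S n)) (b : S n) : Prop := ∀ x, b * x ∈ P → x ∈ P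

theorem RegularMod.colon_eq {P : Ideal (S n)} {b : S n} (h : RegularMod P b) :
    P.colon {b} = P := by
  refine le_antisymm (fun x hx => ?_) fun x hx => ?_
  · rw [Submodule.mem_colon_singleton, smul_eq_mul, mul_comm] at hx
    exact h x hx
  · rw [Submodule.mem_colon_singleton]
    exact P.mul_mem_right b hx

/-- The Hilbert series of `S / I`. -/
def quotientSeries (I : Ideal (S n)) : PowerSeries ℝ := idealSeries (⊤ : Ideal (S n)) - idealSeries I

theorem isGraded_top : IsGraded (⊤ : Ideal (S n)) := Ideal.IsHomogeneous.top _

/-- This is additivity along 0 → (S/(P:b))(-e) → S/P → S/(P,b) → 0. -/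
theorem quotientSeries_sup_span {P : Ideal (S n)} (hP : IsGraded P) {b : S n} {e : ℕ}
    (hb : b.IsHomogeneous e) :
    quotientSeries (P ⊔ Ideal.span {b}) =
      quotientSeries P - PowerSeries.X ^ e * quotientSeries (P.colon {b}) := by
  have h := idealSeries_mul_sup hP isGraded_top hb
  rw [Ideal.mul_top, top_inf_eq, sup_comm] at h
  rw [quotientSeries, h, quotientSeries, quotientSeries]
  ring

/-! ### Exchanging one generator in a colon ideal -/

section Swap

variable {P A : Ideal (S n)} {a b : S n}

/-- Work modulo P. If xA ⊆ (a), then xb = ay because b ∈ A. For s ∈ A write xs = ar; then a(ys) =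
xbs = a(rb), and cancelling a gives ys = rb, so y lies in (b):A. -/
theorem mul_colon_sup_le (hbA : b ∈ A) (ha : RegularMod P a) :
    Ideal.span {b} * (P ⊔ Ideal.span {a}).colon (A : Set (S n)) ⊔ P ≤
      Ideal.span {a} * (P ⊔ Ideal.span {b}).colon (A : Set (S n)) ⊔ P := by
  refine sup_le (fun z hz => ?_) le_sup_right
  obtain ⟨x, hx, rfl⟩ := Ideal.mem_span_singleton_mul.mp hz
  rw [Submodule.mem_colon] at hx
  have hxb := hx b hbA
  rw [sup_comm, smul_eq_mul, Ideal.mem_span_singleton_sup] at hxb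
  obtain ⟨y, p, hp, hy⟩ := hxb
  rw [mul_comm b x, ← hy, mul_comm y a]
  refine Submodule.add_mem_sup (Ideal.mem_span_singleton_mul.mpr ⟨y, ?_, rfl⟩) hp
  rw [Submodule.mem_colon]
  intro s hs
  have hxs := hx s hs
  rw [sup_comm, smul_eq_mul, Ideal.mem_span_singleton_sup] at hxs
  obtain ⟨r, q, hq, hr⟩ := hxs
  rw [sup_comm, smul_eq_mul, Ideal.mem_span_singleton_sup]
  refine ⟨r, y * s - r * b, ha _ ?_, by ring⟩
  have : a * (y * s - r * b) = q * b - p * s := by linear_combination s * hy - b * hr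
  rw [this]
  exact P.sub_mem (P.mul_mem_right _ hq) (P.mul_mem_right _ hp)

theorem mul_colon_sup_eq (haA : a ∈ A) (hbA : b ∈ A) (ha : RegularMod P a)
    (hb : RegularMod P b) :
    Ideal.span {b} * (P ⊔ Ideal.span {a}).colon (A : Set (S n)) ⊔ P =
      Ideal.span {a} * (P ⊔ Ideal.span {b}).colon (A : Set (S n)) ⊔ P :=
  le_antisymm (mul_colon_sup_le hbA ha) (mul_colon_sup_le haA hb)

/-- Both sides are (ab) + P. -/
theorem mul_sup_eq : Ideal.span {b} * (P ⊔ Ideal.span {a}) ⊔ P =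
    Ideal.span {a} * (P ⊔ Ideal.span {b}) ⊔ P := by
  rw [Ideal.mul_sup, Ideal.mul_sup, mul_comm (Ideal.span {b}) (Ideal.span {a})]
  have h : ∀ c : S n, ∀ Q : Ideal (S n), Ideal.span {c} * P ⊔ Q ⊔ P = Q ⊔ P := fun c Q => by
    have hc : Ideal.span {c} * P ≤ Q ⊔ P :=
      le_trans (Ideal.mul_le_right : Ideal.span {c} * P ≤ P) le_sup_right
    rw [sup_assoc, sup_eq_right.mpr hc]
  rw [h, h]

theorem le_colon_self (K : Ideal (S n)) (s : Set (S n)) : K ≤ K.colon s := fun x hx => by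
  rw [Submodule.mem_colon]
  exact fun y _ => K.mul_mem_right y hx

/-- If the socle-type module `((P, a) : A) / (P, a)` vanishes, then so does the one of
`(P, b)`. -/
theorem colon_sup_eq_of_swap (haA : a ∈ A) (ha : RegularMod P a)
    (hb : RegularMod P b)
    (h : (P ⊔ Ideal.span {a}).colon (A : Set (S n)) ≤ P ⊔ Ideal.span {a}) :
    (P ⊔ Ideal.span {b}).colon (A : Set (S n)) ≤ P ⊔ Ideal.span {b} := by
  intro x hx
  -- Modulo P, the product ax lies in a((P,b):A) ⊆ b((P,a):A) ⊆ b(P,a) = a(P,b). Cancelling a then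
  -- puts x in (P,b).
  have h1 : a * x ∈ Ideal.span {a} * (P ⊔ Ideal.span {b}) ⊔ P := by
    rw [← mul_sup_eq]
    exact sup_le_sup_right (Ideal.mul_mono_right h) _ (mul_colon_sup_le haA hb
      ((le_sup_left : _ ≤ _ ⊔ P) (Ideal.mul_mem_mul (Ideal.mem_span_singleton_self a) hx)))
  obtain ⟨y, hy, p, hp, hyp⟩ := Submodule.mem_sup.mp h1
  obtain ⟨z, hz, rfl⟩ := Ideal.mem_span_singleton_mul.mp hy
  have h2 : x - z ∈ P := ha _ (by rw [mul_sub, ← hyp]; simpa using hp)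
  rw [← sub_add_cancel x z]
  exact Ideal.add_mem _ ((le_sup_left : P ≤ _) h2) hz

/-- The Hilbert series of `(K : A) / K`. -/
def colonSeries (K A : Ideal (S n)) : PowerSeries ℝ :=
  idealSeries (K.colon (A : Set (S n))) - idealSeries K

theorem idealSeries_mul_sup_of_regularMod {P X : Ideal (S n)} (hP : IsGraded P)
    (hX : IsGraded X) (hPX : P ≤ X) {e : ℕ} (hb : b.IsHomogeneous e) (hreg : RegularMod P b) :
    idealSeries (Ideal.span {b} * X ⊔ P) =
      idealSeries P + PowerSeries.X ^ e * (idealSeries X - idealSeries P) := by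
  rw [idealSeries_mul_sup hP hX hb, hreg.colon_eq, inf_eq_right.mpr hPX]

theorem isGraded_sup_span (hP : IsGraded P) {α : ℕ} (ha : a.IsHomogeneous α) :
    IsGraded (P ⊔ Ideal.span {a}) :=
  Ideal.IsHomogeneous.sup hP (isGraded_span fun x hx => ⟨α, by rwa [Set.mem_singleton_iff.mp hx]⟩)

/-- Multiplication by b shifts the series of X/P by β whenever P ⊆ X, and likewise a shifts by α.
Taking series in `mul_colon_sup_eq` and `mul_sup_eq` and subtracting gives the formula. -/
theorem colonSeries_swap (hP : IsGraded P) {s : Set (S n)}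
    (hs : ∀ x ∈ s, ∃ e, x.IsHomogeneous e) {α β : ℕ} (hα : a.IsHomogeneous α)
    (hβ : b.IsHomogeneous β) (haA : a ∈ Ideal.span s) (hbA : b ∈ Ideal.span s)
    (ha : RegularMod P a) (hb : RegularMod P b) :
    PowerSeries.X ^ β * colonSeries (P ⊔ Ideal.span {a}) (Ideal.span s) =
      PowerSeries.X ^ α * colonSeries (P ⊔ Ideal.span {b}) (Ideal.span s) := by
  have hga := isGraded_sup_span hP hα
  have hgb := isGraded_sup_span hP hβ
  have h1 := congrArg idealSeries (mul_colon_sup_eq haA hbA ha hb)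
  rw [idealSeries_mul_sup_of_regularMod hP (hga.colon_span hs)
      (le_sup_left.trans (le_colon_self _ _)) hβ hb,
    idealSeries_mul_sup_of_regularMod hP (hgb.colon_span hs)
      (le_sup_left.trans (le_colon_self _ _)) hα ha] at h1
  have h2 := congrArg idealSeries (mul_sup_eq (P := P) (a := a) (b := b))
  rw [idealSeries_mul_sup_of_regularMod hP hga le_sup_left hβ hb,
    idealSeries_mul_sup_of_regularMod hP hgb le_sup_left hα ha] at h2
  simp only [colonSeries]
  linear_combination h1 - h2

end Swap

/-! ### Regular sequences of forms and their permutations -/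

open RingTheory.Sequence in
theorem isWeaklyRegular_append_singleton {L : List (S n)} {a : S n} :
    IsWeaklyRegular (S n) (L ++ [a]) ↔
      IsWeaklyRegular (S n) L ∧ RegularMod (Ideal.ofList L) a := by
  rw [isWeaklyRegular_append_iff, isWeaklyRegular_singleton_iff,
    isSMulRegular_quotient_iff_mem_of_smul_mem, smul_eq_mul, Ideal.mul_top]
  rfl

theorem isGraded_ofList {L : List (S n)} (hL : ∀ a ∈ L, ∃ e, a.IsHomogeneous e) :
    IsGraded (Ideal.ofList L) :=
  isGraded_span hL

theorem mem_irrelevantIdeal_pow {k : ℕ} {x : S n} :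
    x ∈ irrelevantIdeal n ^ k ↔ ∀ u ∈ x.support, k ≤ u.degree :=
  mem_pow_idealOfVars_iff k x

theorem homogeneousComponent_eq_zero_of_mem_pow {k j : ℕ} (hj : j < k) {x : S n}
    (hx : x ∈ irrelevantIdeal n ^ k) : homogeneousComponent j x = 0 :=
  homogeneousComponent_eq_zero' _ _ fun u hu h => by
    have := mem_irrelevantIdeal_pow.mp hx u hu
    omega

/-- Krull's intersection theorem for graded ideals. -/
theorem IsGraded.mem_of_forall_mem_sup_pow {P : Ideal (S n)} (hP : IsGraded P) {x : S n}
    (hx : ∀ k, x ∈ irrelevantIdeal n ^ k ⊔ P) : x ∈ P := by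
  rw [mem_iff_homogeneousComponent_mem hP]
  intro j
  obtain ⟨y, hy, p, hp, rfl⟩ := Submodule.mem_sup.mp (hx (j + 1))
  rw [map_add, homogeneousComponent_eq_zero_of_mem_pow (Nat.lt_succ_self j) hy, zero_add]
  exact isGraded_iff.mp hP p hp j

-- Swapping two neighbours requires that a torsion submodule K with K = aK be zero. Such a K lies in
-- every a^k (S/P), hence in every 𝔪^k (S/P), and the graded Krull theorem takes the place of
-- Nakayama's lemma.
open RingTheory.Sequence in
theorem isWeaklyRegular_perm {L L' : List (S n)} (h : IsWeaklyRegular (S n) L)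
    (hp : L.Perm L') (hL : ∀ a ∈ L, ∃ e, a.IsHomogeneous e)
    (hm : ∀ a ∈ L, a ∈ irrelevantIdeal n) : IsWeaklyRegular (S n) L' := by
  refine h.prototype_perm hp fun a b rs hsub => ?_
  intro K hK
  have hsub' := hsub.subset
  have ha : a ∈ L := hsub' (by simp)
  have hgr : IsGraded (Ideal.ofList rs) :=
    isGraded_ofList fun x hx => hL x (hsub' (by simp [hx]))
  have hpow : ∀ k : ℕ, ∀ x ∈ K, ∃ z ∈ K, a ^ k • z = x := by
    intro k
    induction k with
    | zero => exact fun x hx => ⟨x, hx, by simp⟩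
    | succ k ih =>
      intro x hx
      obtain ⟨z, hz, rfl⟩ := ih x hx
      rw [hK] at hz
      obtain ⟨w, hw, rfl⟩ := (Submodule.mem_smul_pointwise_iff_exists _ _ _).mp hz
      exact ⟨w, hw, by rw [pow_succ, mul_smul]⟩
  rw [eq_bot_iff]
  intro x hx
  obtain ⟨y, rfl⟩ := Submodule.Quotient.mk_surjective _ x
  rw [Submodule.mem_bot, Submodule.Quotient.mk_eq_zero, smul_eq_mul, Ideal.mul_top]
  refine hgr.mem_of_forall_mem_sup_pow fun k => ?_
  obtain ⟨z, -, hz⟩ := hpow k _ hx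
  obtain ⟨w, rfl⟩ := Submodule.Quotient.mk_surjective _ z
  rw [← Submodule.Quotient.mk_smul, Submodule.Quotient.eq, smul_eq_mul, smul_eq_mul,
    Ideal.mul_top] at hz
  have := Ideal.add_mem (irrelevantIdeal n ^ k ⊔ Ideal.ofList rs)
    ((le_sup_left : irrelevantIdeal n ^ k ≤ _)
      (Ideal.mul_mem_right w _ (Ideal.pow_mem_pow (hm a ha) k)))
    ((le_sup_right : Ideal.ofList rs ≤ _) (neg_mem hz))
  simpa using this

/-! ### General combinations and prime avoidance -/

theorem regularMod_iff_forall_associatedPrimes {P : Ideal (S n)} {b : S n} :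
    RegularMod P b ↔ ∀ Q ∈ associatedPrimes (S n) (S n ⧸ P), b ∉ Q := by
  have h := Set.ext_iff.mp (biUnion_associatedPrimes_eq_compl_regular (S n) (S n ⧸ P)) b
  simp only [Set.mem_iUnion, SetLike.mem_coe, Set.mem_compl_iff, Set.mem_ofPred_eq,
    isSMulRegular_quotient_iff_mem_of_smul_mem] at h
  rw [← not_iff_not]
  push Not
  simp only [← exists_prop]
  exact h.symm

/-- The combination `∑ cⁱ fᵢ` of a family of polynomials. -/
def momentComb {N : ℕ} (f : Fin N → S n) (c : ℂ) : S n := ∑ i : Fin N, C (c ^ (i : ℕ)) * f i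

theorem momentComb_mem_span {N : ℕ} (f : Fin N → S n) (c : ℂ) :
    momentComb f c ∈ Ideal.span (Set.range f) :=
  Ideal.sum_mem _ fun i _ => Ideal.mul_mem_left _ _ (Ideal.subset_span ⟨i, rfl⟩)

theorem momentComb_isHomogeneous {N D : ℕ} {f : Fin N → S n} (hf : ∀ i, (f i).IsHomogeneous D)
    (c : ℂ) : (momentComb f c).IsHomogeneous D :=
  IsHomogeneous.sum _ _ _ fun i _ => (hf i).C_mul _

/-- Modulo Q the combination is the value at c of a nonzero polynomial with coefficients f_i in the
domain S/Q, so only finitely many c are roots. -/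
theorem finite_momentComb_mem {N : ℕ} (f : Fin N → S n) (Q : Ideal (S n)) [Q.IsPrime]
    (hQ : ∃ i, f i ∉ Q) : {c : ℂ | momentComb f c ∈ Q}.Finite := by
  obtain ⟨i, hi⟩ := hQ
  let p : Polynomial (S n ⧸ Q) :=
    ∑ j : Fin N, Polynomial.C (Ideal.Quotient.mk Q (f j)) * Polynomial.X ^ (j : ℕ)
  have hp : p ≠ 0 := by
    intro h
    have h1 : p.coeff i = Ideal.Quotient.mk Q (f i) := by
      simp only [p, Polynomial.finsetSum_coeff, Polynomial.coeff_C_mul_X_pow]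
      rw [Finset.sum_eq_single i]
      · simp
      · intro j _ hj
        rw [if_neg fun h => hj (Fin.ext h.symm)]
      · simp
    rw [h, Polynomial.coeff_zero, eq_comm, Ideal.Quotient.eq_zero_iff_mem] at h1
    exact hi h1
  have hinj : Function.Injective (algebraMap ℂ (S n ⧸ Q)) := (algebraMap ℂ (S n ⧸ Q)).injective
  refine ((Polynomial.finite_setOfPred_isRoot hp).preimage hinj.injOn).subset fun c hc => ?_
  rw [Set.mem_ofPred_eq, ← Ideal.Quotient.eq_zero_iff_mem] at hc
  rw [Set.mem_preimage, Set.mem_ofPred_eq, Polynomial.IsRoot, ← hc]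
  simp only [p, Polynomial.eval_finsetSum, Polynomial.eval_mul, Polynomial.eval_C,
    Polynomial.eval_pow, Polynomial.eval_X, momentComb, map_sum, map_mul, map_pow]
  exact Finset.sum_congr rfl fun j _ => mul_comm _ _

/-- There are finitely many associated primes Q of S/P. If one contained all f_i, it would contain
𝔪^k I, hence 𝔪 or I, and so the regular element a in either case. -/
theorem finite_not_regularMod {N : ℕ} {f : Fin N → S n} {I P : Ideal (S n)} {k : ℕ}
    (hI : I ≤ irrelevantIdeal n) (hk : irrelevantIdeal n ^ k * I ≤ Ideal.span (Set.range f))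
    {a : S n} (haI : a ∈ I) (ha : RegularMod P a) :
    {c : ℂ | ¬ RegularMod P (momentComb f c)}.Finite := by
  refine ((associatedPrimes.finite (S n) (S n ⧸ P)).biUnion (t := fun Q =>
    {c : ℂ | momentComb f c ∈ Q}) fun Q hQ => ?_).subset fun c hc => ?_
  · have := IsAssociatedPrime.isPrime hQ
    refine finite_momentComb_mem f Q ?_
    by_contra! h
    refine regularMod_iff_forall_associatedPrimes.mp ha Q hQ ?_
    have hle : irrelevantIdeal n ^ k * I ≤ Q :=
      hk.trans (Ideal.span_le.mpr (by rintro _ ⟨i, rfl⟩; exact h i))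
    rcases (Ideal.IsPrime.mul_le ‹_›).mp hle with h1 | h1
    · exact Ideal.IsPrime.le_of_pow_le h1 (hI haI)
    · exact h1 haI
  · rw [Set.mem_ofPred_eq, regularMod_iff_forall_associatedPrimes] at hc
    push Not at hc
    obtain ⟨Q, hQ, hcQ⟩ := hc
    exact Set.mem_biUnion hQ hcQ

/-- For N distinct parameters the Vandermonde matrix is invertible, so the f_i are recovered from
the combinations. -/
theorem span_range_le_ofList_momentComb {N : ℕ} (f : Fin N → S n) {cs : List ℂ} (hcs : cs.Nodup)
    (hlen : cs.length = N) :
    Ideal.span (Set.range f) ≤ Ideal.ofList (cs.map (momentComb f)) := by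
  subst hlen
  have hV : IsUnit (Matrix.vandermonde cs.get).det :=
    (Matrix.det_vandermonde_ne_zero_iff.mpr (List.nodup_iff_injective_get.mp hcs)).isUnit
  have hinv := Matrix.nonsing_inv_mul _ hV
  refine Ideal.span_le.mpr ?_
  rintro _ ⟨l, rfl⟩
  have h : f l = ∑ i, C ((Matrix.vandermonde cs.get)⁻¹ l i) * momentComb f (cs.get i) := by
    simp only [momentComb, Finset.mul_sum, ← mul_assoc, ← C_mul]
    rw [Finset.sum_comm]
    have : ∀ j : Fin cs.length,
        ∑ i, C ((Matrix.vandermonde cs.get)⁻¹ l i * cs.get i ^ (j : ℕ)) * f j =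
        C ((1 : Matrix _ _ ℂ) l j) * f j := fun j => by
      rw [← hinv, Matrix.mul_apply, map_sum, Finset.sum_mul]
      rfl
    simp only [this, Matrix.one_apply]
    simp
  rw [h]
  exact Ideal.sum_mem _ fun i _ => Ideal.mul_mem_left _ _
    (Ideal.subset_span (List.mem_map_of_mem (List.get_mem cs i)))

theorem quotientSeries_ofList {L : List (S n)} {δ : S n → ℕ}
    (hL : ∀ a ∈ L, a.IsHomogeneous (δ a))
    (hreg : RingTheory.Sequence.IsWeaklyRegular (S n) L) :
    quotientSeries (Ideal.ofList L) =
      quotientSeries (⊥ : Ideal (S n)) * (L.map fun a => 1 - PowerSeries.X ^ δ a).prod := by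
  induction L using List.reverseRecOn with
  | nil => simp
  | append_singleton L a ih =>
    have hLa : ∀ a ∈ L, a.IsHomogeneous (δ a) := fun b hb => hL b (by simp [hb])
    obtain ⟨h1, h2⟩ := isWeaklyRegular_append_singleton.mp hreg
    rw [Ideal.ofList_append, Ideal.ofList_singleton,
      quotientSeries_sup_span (isGraded_ofList fun b hb => ⟨_, hLa b hb⟩) (hL a (by simp)),
      h2.colon_eq, ih hLa h1]
    simp
    ring

/-- The elements of a regular sequence can be exchanged one at a time against sufficiently
general combinations of the `fᵢ`. -/
theorem exists_exchange {N D : ℕ} {f : Fin N → S n} (hf : ∀ i, (f i).IsHomogeneous D)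
    {s : Set (S n)} (hs : ∀ x ∈ s, ∃ e, x.IsHomogeneous e) {k : ℕ}
    (hI : Ideal.span s ≤ irrelevantIdeal n)
    (hk : irrelevantIdeal n ^ k * Ideal.span s ≤ Ideal.span (Set.range f))
    (hJ : Ideal.span (Set.range f) ≤ Ideal.span s) {δ : S n → ℕ} (G : List (S n)) (cs : List ℂ)
    (hcs : cs.Nodup) (hG : ∀ g ∈ G, g ∈ Ideal.span s ∧ g.IsHomogeneous (δ g))
    (hreg : RingTheory.Sequence.IsWeaklyRegular (S n) (G ++ cs.map (momentComb f))) :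
    ∃ cs' : List ℂ, cs'.Nodup ∧ cs'.length = G.length + cs.length ∧
      RingTheory.Sequence.IsWeaklyRegular (S n) (cs'.map (momentComb f)) ∧
      ((Ideal.ofList (G ++ cs.map (momentComb f))).colon (irrelevantIdeal n : Set (S n)) ≤
          Ideal.ofList (G ++ cs.map (momentComb f)) →
        (Ideal.ofList (cs'.map (momentComb f))).colon (irrelevantIdeal n : Set (S n)) ≤
          Ideal.ofList (cs'.map (momentComb f))) ∧
      PowerSeries.X ^ (G.map δ).sum *
          colonSeries (Ideal.ofList (cs'.map (momentComb f))) (Ideal.span s) =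
        PowerSeries.X ^ (D * G.length) *
          colonSeries (Ideal.ofList (G ++ cs.map (momentComb f))) (Ideal.span s) := by
  induction G generalizing cs with
  | nil => exact ⟨cs, hcs, by simp, by simpa using hreg, by simp, by simp⟩
  | cons g G ih =>
    set H := cs.map (momentComb f) with hH
    obtain ⟨hgI, hgδ⟩ := hG g (by simp)
    have hG' : ∀ g ∈ G, g ∈ Ideal.span s ∧ g.IsHomogeneous (δ g) :=
      fun x hx => hG x (by simp [hx])
    have hHom : ∀ x ∈ G ++ H, (∃ e, x.IsHomogeneous e) ∧ x ∈ irrelevantIdeal n := by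
      intro x hx
      rcases List.mem_append.mp hx with hx | hx
      · exact ⟨⟨_, (hG' x hx).2⟩, hI (hG' x hx).1⟩
      · obtain ⟨c, -, rfl⟩ := List.mem_map.mp hx
        exact ⟨⟨_, momentComb_isHomogeneous hf c⟩, hI (hJ (momentComb_mem_span f c))⟩
    -- With g moved to the end, P = (G, H) becomes the common base modulo which g is exchanged.
    have hreg1 : RingTheory.Sequence.IsWeaklyRegular (S n) ((G ++ H) ++ [g]) := by
      refine isWeaklyRegular_perm hreg (List.perm_append_singleton g (G ++ H)).symm ?_ ?_
      · rintro x (_ | ⟨_, hx⟩)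
        exacts [⟨_, hgδ⟩, (hHom x hx).1]
      · rintro x (_ | ⟨_, hx⟩)
        exacts [hI hgI, (hHom x hx).2]
    obtain ⟨hreg2, hg⟩ := isWeaklyRegular_append_singleton.mp hreg1
    -- The parameter also avoids `cs`, since distinctness is needed for the Vandermonde argument.
    obtain ⟨c, hc⟩ := ((finite_not_regularMod hI hk hgI hg).union
      (List.finite_toSet cs)).infinite_compl.nonempty
    simp only [Set.mem_compl_iff, Set.mem_union, Set.mem_ofPred_eq, not_or, not_not] at hc
    obtain ⟨hc, hccs⟩ := hc
    have hreg3 : RingTheory.Sequence.IsWeaklyRegular (S n)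
        (G ++ (c :: cs).map (momentComb f)) := by
      refine isWeaklyRegular_perm (isWeaklyRegular_append_singleton.mpr ⟨hreg2, hc⟩)
        ((List.perm_append_singleton _ _).trans List.perm_middle.symm) ?_ ?_
      · intro x hx
        rcases List.mem_append.mp hx with hx | hx
        · exact (hHom x hx).1
        · rw [List.mem_singleton.mp hx]
          exact ⟨_, momentComb_isHomogeneous hf c⟩
      · intro x hx
        rcases List.mem_append.mp hx with hx | hx
        · exact (hHom x hx).2
        · rw [List.mem_singleton.mp hx]
          exact hI (hJ (momentComb_mem_span f c))
    obtain ⟨cs', hnd, hlen, hreg', hsat, hser⟩ :=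
      ih (c :: cs) (List.nodup_cons.mpr ⟨hccs, hcs⟩) hG' hreg3
    have hof1 : Ideal.ofList (g :: G ++ H) = Ideal.ofList (G ++ H) ⊔ Ideal.span {g} := by
      rw [List.cons_append, Ideal.ofList_cons, sup_comm]
    have hof2 : Ideal.ofList (G ++ (c :: cs).map (momentComb f)) =
        Ideal.ofList (G ++ H) ⊔ Ideal.span {momentComb f c} := by
      rw [List.map_cons, Ideal.ofList_append, Ideal.ofList_cons, Ideal.ofList_append]
      ac_rfl
    refine ⟨cs', hnd, by rw [hlen]; simp only [List.length_cons]; ring, hreg', fun h => hsat ?_, ?_⟩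
    · rw [hof1] at h
      rw [hof2]
      exact colon_sup_eq_of_swap (hI hgI) hg hc h
    · have hsw := colonSeries_swap (isGraded_ofList fun x hx => (hHom x hx).1) hs hgδ
        (momentComb_isHomogeneous hf c) hgI (hJ (momentComb_mem_span f c)) hg hc
      rw [hof2] at hser
      rw [hof1, List.map_cons, List.sum_cons, pow_add, List.length_cons, mul_add, mul_one,
        pow_add]
      linear_combination PowerSeries.X ^ δ g * hser - PowerSeries.X ^ (D * G.length) * hsw

/-! ### The irrelevant ideal and the Hilbert series of S -/

theorem mem_irrelevantIdeal_iff {x : S n} : x ∈ irrelevantIdeal n ↔ coeff 0 x = 0 := by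
  rw [← pow_one (irrelevantIdeal n), mem_irrelevantIdeal_pow]
  refine ⟨fun h => ?_, fun h u hu => ?_⟩
  · by_contra h0
    simpa using h 0 (mem_support_iff.mpr h0)
  · by_contra hlt
    have : u = 0 := (Finsupp.degree_eq_zero_iff u).mp (by omega)
    exact mem_support_iff.mp hu (this ▸ h)

theorem mem_irrelevantIdeal_of_isHomogeneous {x : S n} {e : ℕ} (hx : x.IsHomogeneous e)
    (he : e ≠ 0) : x ∈ irrelevantIdeal n :=
  mem_irrelevantIdeal_iff.mpr (hx.coeff_eq_zero (by simpa using he.symm))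

theorem isUnit_of_notMem_irrelevantIdeal {x : S n} {e : ℕ} (hx : x.IsHomogeneous e)
    (hm : x ∉ irrelevantIdeal n) : e = 0 ∧ IsUnit x := by
  have he : e = 0 := by
    by_contra he
    exact hm (mem_irrelevantIdeal_of_isHomogeneous hx he)
  subst he
  refine ⟨rfl, ?_⟩
  have h := homogeneousComponent_eq_self hx
  rw [homogeneousComponent_zero] at h
  rw [← h]
  exact ((isUnit_iff_ne_zero.mpr fun h0 => hm (mem_irrelevantIdeal_iff.mpr h0)).map C)

theorem degPart_zero_eq_bot {I : Ideal (S n)} (hI : I ≤ irrelevantIdeal n) :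
    degPart I 0 = ⊥ := by
  rw [eq_bot_iff]
  intro x hx
  have h := homogeneousComponent_eq_self hx.2
  rw [homogeneousComponent_zero, mem_irrelevantIdeal_iff.mp (hI hx.1), C_0] at h
  exact h.symm

theorem degPart_top_zero : Module.finrank ℂ (degPart (⊤ : Ideal (S n)) 0) = 1 := by
  have : degPart (⊤ : Ideal (S n)) 0 = Submodule.span ℂ {1} := by
    rw [← Submodule.one_eq_span, ← homogeneousSubmodule_zero]
    ext x
    exact ⟨And.right, fun h => ⟨Submodule.mem_top, h⟩⟩
  rw [this, finrank_span_singleton one_ne_zero]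

theorem coeff_zero_quotientSeries {I : Ideal (S n)} (hI : I ≤ irrelevantIdeal n) :
    PowerSeries.coeff 0 (quotientSeries I) = 1 := by
  rw [quotientSeries, map_sub, coeff_idealSeries, coeff_idealSeries, degPart_top_zero,
    degPart_zero_eq_bot hI]
  simp

theorem quotientSeries_irrelevantIdeal : quotientSeries (irrelevantIdeal n) = 1 := by
  ext k
  rcases Nat.eq_zero_or_pos k with rfl | hk
  · rw [coeff_zero_quotientSeries le_rfl]
    simp
  · have : degPart (⊤ : Ideal (S n)) k = degPart (irrelevantIdeal n) k := by
      ext x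
      simp only [mem_degPart, Submodule.mem_top, true_and]
      exact ⟨fun h => ⟨mem_irrelevantIdeal_of_isHomogeneous h hk.ne', h⟩, And.right⟩
    rw [quotientSeries, map_sub, coeff_idealSeries, coeff_idealSeries, this, sub_self,
      PowerSeries.coeff_one, if_neg hk.ne']

theorem ofList_map_X (L : List (Fin (n + 1))) :
    Ideal.ofList (L.map (X : Fin (n + 1) → S n)) = Ideal.span (X '' {j | j ∈ L}) :=
  congrArg Ideal.span (Set.ext fun x => by simp)

theorem isWeaklyRegular_map_X {L : List (Fin (n + 1))} (hL : L.Nodup) :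
    RingTheory.Sequence.IsWeaklyRegular (S n) (L.map (X : Fin (n + 1) → S n)) := by
  induction L using List.reverseRecOn with
  | nil => exact .nil _ _
  | append_singleton L i ih =>
    rw [List.map_append, List.map_singleton, isWeaklyRegular_append_singleton]
    have hi : i ∉ L := fun h => (List.nodup_append.mp hL).2.2 i h i (by simp) rfl
    refine ⟨ih (List.nodup_append.mp hL).1, fun x hx => ?_⟩
    rw [ofList_map_X, mem_ideal_span_X_image] at hx ⊢
    intro u hu
    obtain ⟨j, hj, hne⟩ := hx (Finsupp.single i 1 + u) (by
      rw [mem_support_iff, coeff_X_mul]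
      exact mem_support_iff.mp hu)
    have hij : i ≠ j := fun h => hi (h ▸ hj)
    exact ⟨j, hj, by simpa [Finsupp.single_apply, hij] using hne⟩

theorem ofList_map_X_finRange :
    Ideal.ofList ((List.finRange (n + 1)).map (X : Fin (n + 1) → S n)) = irrelevantIdeal n := by
  rw [ofList_map_X, irrelevantIdeal, ← Set.image_univ]
  simp

theorem quotientSeries_ofList_const {L : List (S n)} {D : ℕ} (hL : ∀ a ∈ L, a.IsHomogeneous D)
    (hreg : RingTheory.Sequence.IsWeaklyRegular (S n) L) :
    quotientSeries (Ideal.ofList L) =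
      quotientSeries (⊥ : Ideal (S n)) * (1 - PowerSeries.X ^ D) ^ L.length := by
  rw [quotientSeries_ofList (δ := fun _ => D) hL hreg, List.map_const', List.prod_replicate]

/-- The complete intersection formula applied to the variables computes H(S) from H(S/𝔪) = 1, with
no count of monomials. -/
theorem quotientSeries_bot_mul :
    quotientSeries (⊥ : Ideal (S n)) * (1 - PowerSeries.X) ^ (n + 1) = 1 := by
  have h := quotientSeries_ofList_const (D := 1)
    (L := (List.finRange (n + 1)).map (X : Fin (n + 1) → S n)) (fun a ha => by
      obtain ⟨i, -, rfl⟩ := List.mem_map.mp ha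
      exact isHomogeneous_X _ _) (isWeaklyRegular_map_X (List.nodup_finRange _))
  rw [ofList_map_X_finRange, quotientSeries_irrelevantIdeal] at h
  simpa using h.symm

/-! ### Hilbert series of M(f) and N(f), and saturation -/

theorem finrank_map_add_finrank_inf_ker {E F : Type*} [AddCommGroup E] [Module ℂ E]
    [AddCommGroup F] [Module ℂ F] (φ : E →ₗ[ℂ] F) (V : Submodule ℂ E) [FiniteDimensional ℂ V] :
    Module.finrank ℂ (V.map φ) + Module.finrank ℂ (V ⊓ LinearMap.ker φ : Submodule ℂ E) =
      Module.finrank ℂ V := by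
  have h := LinearMap.finrank_range_add_finrank_ker (φ.domRestrict V)
  rw [LinearMap.range_domRestrict, LinearMap.ker_domRestrict] at h
  rw [← h, (Submodule.equivSubtypeMap V (Submodule.comap V.subtype φ.ker)).finrank_eq,
    Submodule.map_comap_subtype]

theorem hilbertPoincare_map_mk {I J : Ideal (S n)} (hJI : J ≤ I) :
    hilbertPoincare (fun k => (degPart I k).map (Ideal.Quotient.mkₐ ℂ J).toLinearMap) =
      idealSeries I - idealSeries J := by
  ext k
  rw [map_sub, coeff_idealSeries, coeff_idealSeries, hilbertPoincare, PowerSeries.coeff_mk]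
  have h := finrank_map_add_finrank_inf_ker (Ideal.Quotient.mkₐ ℂ J).toLinearMap (degPart I k)
  have hker : degPart I k ⊓ LinearMap.ker (Ideal.Quotient.mkₐ ℂ J).toLinearMap =
      degPart J k := by
    ext x
    have : x ∈ LinearMap.ker (Ideal.Quotient.mkₐ ℂ J).toLinearMap ↔ x ∈ J := by
      rw [LinearMap.mem_ker]
      exact Ideal.Quotient.eq_zero_iff_mem
    rw [Submodule.mem_inf, this, mem_degPart, mem_degPart]
    exact ⟨fun h => ⟨h.2, h.1.2⟩, fun h => ⟨⟨hJI h.1, h.2⟩, h.1⟩⟩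
  rw [hker] at h
  rw [eq_sub_iff_add_eq]
  exact_mod_cast h

theorem hilbertPoincare_milnorPiece (f : S n) :
    hilbertPoincare (milnorPiece f) = quotientSeries (jacobianIdeal f) := by
  rw [quotientSeries, ← hilbertPoincare_map_mk le_top]
  congr 1
  funext k
  rw [milnorPiece]
  congr 1
  ext x
  simp [mem_degPart]

theorem le_saturation (I : Ideal (S n)) : I ≤ saturation I :=
  fun _ hx => ⟨0, fun h _ => I.mul_mem_left h hx⟩

theorem hilbertPoincare_localCohomologyPiece (f : S n) :
    hilbertPoincare (localCohomologyPiece f) =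
      idealSeries (saturation (jacobianIdeal f)) - idealSeries (jacobianIdeal f) := by
  rw [← hilbertPoincare_map_mk (le_saturation _)]
  congr 1
  funext k
  ext y
  constructor
  · rintro ⟨hy, x, hx, rfl⟩
    obtain ⟨z, hz, hzx⟩ := (Ideal.mem_map_iff_of_surjective _ Ideal.Quotient.mk_surjective).mp hy
    refine ⟨x, ⟨?_, hx⟩, rfl⟩
    have h : x - z ∈ jacobianIdeal f := Ideal.Quotient.eq.mp hzx.symm
    rw [SetLike.mem_coe, Submodule.restrictScalars_mem, ← sub_add_cancel x z]
    exact Ideal.add_mem _ (le_saturation _ h) hz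
  · rintro ⟨x, hx, rfl⟩
    exact ⟨Ideal.mem_map_of_mem _ hx.1, x, hx.2, rfl⟩

theorem exists_pow_mul_le_of_le_saturation {J A : Ideal (S n)} (hA : A ≤ saturation J) :
    ∃ k, irrelevantIdeal n ^ k * A ≤ J := by
  obtain ⟨t, rfl⟩ := IsNoetherian.noetherian A
  choose! k hk using fun x (hx : x ∈ t) => hA (Ideal.subset_span hx)
  refine ⟨t.sup k, Ideal.mul_le.mpr fun r hr y hy => ?_⟩
  induction hy using Submodule.span_induction with
  | mem x hx => exact hk x hx r (Ideal.pow_le_pow_right (Finset.le_sup hx) hr)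
  | zero => simp
  | add y z _ _ h1 h2 => rw [mul_add]; exact J.add_mem h1 h2
  | smul a y _ h => rw [smul_eq_mul, mul_left_comm]; exact J.mul_mem_left a h

/-- If 𝔪x lies in the saturation, finite generation of 𝔪x gives one k with 𝔪^k(𝔪x) ⊆ J, so k + 1
works for x. -/
theorem colon_saturation_le (J : Ideal (S n)) :
    (saturation J).colon (irrelevantIdeal n : Set (S n)) ≤ saturation J := by
  intro x hx
  rw [Submodule.mem_colon] at hx
  obtain ⟨k, hk⟩ := exists_pow_mul_le_of_le_saturation (J := J)
    (A := irrelevantIdeal n * Ideal.span {x}) (Ideal.mul_le.mpr fun r hr y hy => by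
      obtain ⟨a, rfl⟩ := Ideal.mem_span_singleton'.mp hy
      rw [mul_left_comm, mul_comm r]
      exact Ideal.mul_mem_left _ _ (hx r hr))
  refine ⟨k + 1, fun h hh => hk ?_⟩
  rw [← mul_assoc, ← pow_succ]
  exact Ideal.mul_mem_mul hh (Ideal.mem_span_singleton_self x)

theorem mem_of_forall_pow_mul_mem {K : Ideal (S n)}
    (hK : K.colon (irrelevantIdeal n : Set (S n)) ≤ K) (k : ℕ) {x : S n}
    (hx : ∀ r ∈ irrelevantIdeal n ^ k, r * x ∈ K) : x ∈ K := by
  induction k generalizing x with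
  | zero => simpa using hx 1 (by simp)
  | succ k ih =>
    refine ih fun r hr => hK ?_
    rw [Submodule.mem_colon]
    intro s hs
    rw [smul_eq_mul, mul_right_comm]
    exact hx _ (by rw [pow_succ]; exact Ideal.mul_mem_mul hr hs)

/-! ### The Jacobian ideal of a smooth hypersurface -/

theorem eval_smul_of_isHomogeneous {f : S n} {d : ℕ} (hf : f.IsHomogeneous d) (c : ℂ)
    (p : Fin (n + 1) → ℂ) : eval (c • p) f = c ^ d * eval p f := by
  rw [eval_eq, eval_eq, Finset.mul_sum]
  refine Finset.sum_congr rfl fun u hu => ?_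
  rw [hf.degree_eq_sum_deg_support hu]
  simp only [Pi.smul_apply, smul_eq_mul, mul_pow, Finset.prod_mul_distrib,
    Finset.prod_pow_eq_pow_sum]
  ring

/-- By the Nullstellensatz it suffices that the partials have no common zero p ≠ 0. Euler's
relation, with d ≠ 0, places such a p on V(f), where it would be a singular point. -/
theorem exists_pow_le_jacobianIdeal {f : S n} {d : ℕ} (hd : 1 ≤ d) (hf : f.IsHomogeneous d)
    (hs : IsSmoothHypersurface f) : ∃ k, irrelevantIdeal n ^ k ≤ jacobianIdeal f := by
  refine Ideal.exists_pow_le_of_le_radical_of_fg ?_ (IsNoetherian.noetherian _)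
  rw [← vanishingIdeal_zeroLocus_eq_radical (K := ℂ), irrelevantIdeal, Ideal.span_le]
  rintro _ ⟨i, rfl⟩
  rw [SetLike.mem_coe, mem_vanishingIdeal_iff]
  intro p hp
  rw [mem_zeroLocus_iff] at hp
  have hp' : ∀ j, eval p (pderiv j f) = 0 := fun j => by
    simpa [aeval_eq_eval] using hp _ (Ideal.subset_span ⟨j, rfl⟩)
  suffices p = 0 by simp [this]
  by_contra hp0
  have hfp : eval p f = 0 := by
    have h := congrArg (eval p) hf.sum_X_mul_pderiv
    simp only [map_sum, map_mul, hp', mul_zero, Finset.sum_const_zero, nsmul_eq_mul] at h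
    rcases mul_eq_zero.mp h.symm with h | h
    · have : d = 0 := by simpa using h
      omega
    · exact h
  obtain ⟨a, ha⟩ := Projectivization.exists_smul_eq_mk_rep ℂ p hp0
  have hmem : Projectivization.mk ℂ p hp0 ∈ singularLocus f := by
    have ha' : (Projectivization.mk ℂ p hp0).rep = (a : ℂ) • p := ha.symm
    refine ⟨?_, fun j => ?_⟩
    · rw [ha', eval_smul_of_isHomogeneous hf, hfp, mul_zero]
    · rw [ha', eval_smul_of_isHomogeneous hf.pderiv, hp', mul_zero]
  rw [hs] at hmem
  exact hmem

theorem quotientSeries_jacobianIdeal_of_isSmooth {f : S n} {d : ℕ} (hd : 1 ≤ d)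
    (hf : f.IsHomogeneous d) (hs : IsSmoothHypersurface f) :
    quotientSeries (jacobianIdeal f) =
      quotientSeries (⊥ : Ideal (S n)) * (1 - PowerSeries.X ^ (d - 1)) ^ (n + 1) := by
  have hpd : ∀ i, (pderiv i f).IsHomogeneous (d - 1) := fun i => hf.pderiv
  by_cases hJ : jacobianIdeal f ≤ irrelevantIdeal n
  · obtain ⟨k, hk⟩ := exists_pow_le_jacobianIdeal hd hf hs
    -- All n + 1 variables are exchanged for combinations of the n + 1 partials, which therefore
    -- generate the whole Jacobian ideal.
    obtain ⟨cs, hnd, hlen, hreg, -, -⟩ := exists_exchange (s := Set.range X) (δ := fun _ => 1) hpd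
      (by rintro _ ⟨i, rfl⟩; exact ⟨1, isHomogeneous_X _ _⟩) le_rfl
      (Ideal.mul_le_left.trans hk) hJ ((List.finRange (n + 1)).map X) [] List.nodup_nil
      (by
        rintro g hg
        obtain ⟨i, -, rfl⟩ := List.mem_map.mp hg
        exact ⟨Ideal.subset_span ⟨i, rfl⟩, isHomogeneous_X _ _⟩)
      (by simpa using isWeaklyRegular_map_X (List.nodup_finRange _))
    have hlen' : cs.length = n + 1 := by simpa using hlen
    have hK : jacobianIdeal f = Ideal.ofList (cs.map (momentComb fun i => pderiv i f)) := by
      refine le_antisymm (span_range_le_ofList_momentComb _ hnd hlen') (Ideal.span_le.mpr ?_)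
      intro x hx
      obtain ⟨c, -, rfl⟩ := List.mem_map.mp hx
      exact momentComb_mem_span _ c
    rw [hK, quotientSeries_ofList_const (D := d - 1) _ hreg, List.length_map, hlen']
    · intro x hx
      obtain ⟨c, -, rfl⟩ := List.mem_map.mp hx
      exact momentComb_isHomogeneous hpd c
  -- Here some partial is a nonzero constant, so d - 1 = 0 and J = S. Both sides vanish because 1 -
  -- X ^ 0 = 0.
  · obtain ⟨i, hi⟩ : ∃ i, pderiv i f ∉ irrelevantIdeal n := by
      by_contra! h
      exact hJ (Ideal.span_le.mpr (by rintro _ ⟨i, rfl⟩; exact h i))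
    obtain ⟨h0, hu⟩ := isUnit_of_notMem_irrelevantIdeal (hpd i) hi
    have htop : jacobianIdeal f = ⊤ := Ideal.eq_top_of_isUnit_mem _ (Ideal.subset_span ⟨i, rfl⟩) hu
    rw [htop, h0, quotientSeries]
    simp

/-! ### Linkage for a Jacobian ideal with complete intersection saturation -/

/-- Zero is regular only on the zero module, which properness of the ideal excludes. Nonvanishing
lets `totalDegree` serve as the degree function on the generators. -/
theorem ne_zero_of_isRegular {L : List (S n)} (hL : RingTheory.Sequence.IsRegular (S n) L)
    {a : S n} (ha : a ∈ L) : a ≠ 0 := by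
  rintro rfl
  obtain ⟨i, hi, h0⟩ := List.mem_iff_getElem.mp ha
  have h := hL.regular_mod_prev i hi
  rw [h0, IsSMulRegular.zero_iff_subsingleton, Submodule.Quotient.subsingleton_iff] at h
  refine hL.top_ne_smul (le_antisymm (h.symm.trans_le ?_) le_top)
  exact Submodule.smul_mono_left (Ideal.span_mono fun x hx => List.mem_of_mem_take hx)

theorem coe_geomPoly_mul (m : ℕ) :
    ((geomPoly m : Polynomial ℝ) : PowerSeries ℝ) * (1 - PowerSeries.X) =
      1 - PowerSeries.X ^ m := by
  have h : geomPoly m * (1 - Polynomial.X) = 1 - Polynomial.X ^ m := geom_sum_mul_neg _ _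
  have := congrArg (fun p : Polynomial ℝ => (p : PowerSeries ℝ)) h
  simpa using this

/-- The Hilbert series of `S / J` for an ideal `J` generated by `n + 1` forms of degree `D`
whose saturation is a complete intersection `I` of codimension `n`. -/
theorem quotientSeries_of_saturation {D : ℕ} {f : Fin (n + 1) → S n}
    (hf : ∀ i, (f i).IsHomogeneous D) {e : Fin n → ℕ}
    (hci : IsCompleteIntersection (saturation (Ideal.span (Set.range f))) e) :
    ∃ m, m + ∑ i, e i = D * n ∧
      quotientSeries (saturation (Ideal.span (Set.range f))) =
        quotientSeries (⊥ : Ideal (S n)) * ∏ i, (1 - PowerSeries.X ^ e i) ∧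
      quotientSeries (Ideal.span (Set.range f)) =
        quotientSeries (⊥ : Ideal (S n)) * (1 - PowerSeries.X ^ D) ^ (n + 1) +
          PowerSeries.X ^ (D + m) * quotientSeries (saturation (Ideal.span (Set.range f))) := by
  obtain ⟨g, hg, hreg, hI⟩ := hci
  set J := Ideal.span (Set.range f) with hJdef
  set I := saturation J with hIdef
  have hofFn : Ideal.ofList (List.ofFn g) = I := by
    rw [hI, Ideal.ofList]
    congr 1
    ext x
    simp [List.mem_ofFn]
  have hItop : I ≠ ⊤ := by
    intro h
    apply hreg.top_ne_smul
    rw [hofFn, h, smul_eq_mul, Ideal.mul_top]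
  have hgδ : ∀ i, (g i).totalDegree = e i := fun i =>
    (hg i).totalDegree (ne_zero_of_isRegular hreg (List.mem_ofFn.mpr ⟨i, rfl⟩))
  have hgI : ∀ i, g i ∈ I := fun i => hI ▸ Ideal.subset_span ⟨i, rfl⟩
  have hIm : I ≤ irrelevantIdeal n := by
    rw [hI, Ideal.span_le]
    rintro _ ⟨i, rfl⟩
    by_contra h
    exact hItop (Ideal.eq_top_of_isUnit_mem _ (hgI i) (isUnit_of_notMem_irrelevantIdeal (hg i) h).2)
  obtain ⟨k, hk⟩ := exists_pow_mul_le_of_le_saturation (le_refl I)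
  have hJI : J ≤ I := le_saturation J
  have hs : ∀ x ∈ Set.range g, ∃ e, x.IsHomogeneous e := by
    rintro _ ⟨i, rfl⟩
    exact ⟨_, hg i⟩
  have hG : ∀ x ∈ List.ofFn g, x ∈ Ideal.span (Set.range g) ∧ x.IsHomogeneous x.totalDegree := by
    intro x hx
    obtain ⟨i, rfl⟩ := List.mem_ofFn.mp hx
    exact ⟨Ideal.subset_span ⟨i, rfl⟩, (hgδ i).symm ▸ hg i⟩
  obtain ⟨cs, hnd, hlen, hregK, hsat, hser⟩ := exists_exchange (δ := totalDegree) hf hs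
    (hI ▸ hIm) (hI ▸ hk) (hI ▸ hJI) (List.ofFn g) [] List.nodup_nil hG
    (by simpa using hreg.toIsWeaklyRegular)
  set K := Ideal.ofList (cs.map (momentComb f)) with hK
  rw [List.map_nil, List.append_nil, hofFn] at hsat hser
  have hsatK := hsat (colon_saturation_le J)
  have hlen' : cs.length = n := by simpa using hlen
  have hII : I.colon (I : Set (S n)) = ⊤ := by
    rw [eq_top_iff]
    intro x _
    rw [Submodule.mem_colon]
    exact fun y hy => I.mul_mem_left x hy
  have hsum : ((List.ofFn g).map totalDegree).sum = ∑ i, e i := by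
    rw [List.map_ofFn, List.sum_ofFn]
    exact Finset.sum_congr rfl fun i _ => hgδ i
  rw [← hI, hsum, colonSeries, colonSeries, hII, ← quotientSeries, List.length_ofFn] at hser
  -- S/I has constant term 1, so the right side of `hser` has coefficient 1 at t^(Dn), whereas the
  -- left side is divisible by t^(∑ e_i).
  have hle : ∑ i, e i ≤ D * n := by
    by_contra hlt
    have := congrArg (PowerSeries.coeff (D * n)) hser
    rw [PowerSeries.coeff_X_pow_mul', if_neg hlt, PowerSeries.coeff_X_pow_mul', if_pos le_rfl,
      Nat.sub_self, coeff_zero_quotientSeries hIm] at this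
    exact zero_ne_one this
  obtain ⟨m, hm⟩ := Nat.exists_eq_add_of_le' hle
  rw [hm, add_comm m, pow_add, mul_assoc] at hser
  have hQ := mul_left_cancel₀ (pow_ne_zero _ PowerSeries.X_ne_zero) hser
  -- Only distinctness from the n earlier parameters matters: n + 1 combinations generate J.
  -- Regularity modulo K is not required.
  obtain ⟨c, hc⟩ := (List.finite_toSet cs).infinite_compl.nonempty
  have hJK : J = K ⊔ Ideal.span {momentComb f c} := by
    refine le_antisymm ?_ (sup_le (Ideal.span_le.mpr ?_) ?_)
    · have := span_range_le_ofList_momentComb f (cs := c :: cs) (List.nodup_cons.mpr ⟨hc, hnd⟩)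
        (by simp [hlen'])
      rwa [List.map_cons, Ideal.ofList_cons, sup_comm] at this
    · intro x hx
      obtain ⟨c, -, rfl⟩ := List.mem_map.mp hx
      exact momentComb_mem_span f c
    · rw [Ideal.span_singleton_le_iff_mem]
      exact momentComb_mem_span f c
  -- If x multiplies the last generator into K, then xJ ⊆ K, so 𝔪^k xI ⊆ K, and saturation of K
  -- gives xI ⊆ K.
  have hcolon : K.colon {momentComb f c} = K.colon (I : Set (S n)) := by
    refine le_antisymm (fun x hx => ?_) fun x hx => ?_
    · rw [Submodule.mem_colon_singleton, smul_eq_mul] at hx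
      have hxJ : ∀ y ∈ J, x * y ∈ K := by
        intro y hy
        rw [hJK, sup_comm, Ideal.mem_span_singleton_sup] at hy
        obtain ⟨a, z, hz, rfl⟩ := hy
        rw [mul_add, mul_left_comm]
        exact K.add_mem (K.mul_mem_left _ hx) (K.mul_mem_left _ hz)
      rw [Submodule.mem_colon]
      intro y hy
      refine mem_of_forall_pow_mul_mem hsatK k fun r hr => ?_
      rw [smul_eq_mul, mul_left_comm]
      exact hxJ _ (hk (Ideal.mul_mem_mul hr hy))
    · rw [Submodule.mem_colon] at hx
      rw [Submodule.mem_colon_singleton]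
      exact hx _ (hJI (momentComb_mem_span f c))
  have hKhom : ∀ x ∈ cs.map (momentComb f), x.IsHomogeneous D := by
    intro x hx
    obtain ⟨c, -, rfl⟩ := List.mem_map.mp hx
    exact momentComb_isHomogeneous hf c
  have hqK : quotientSeries K =
      quotientSeries (⊥ : Ideal (S n)) * (1 - PowerSeries.X ^ D) ^ n := by
    rw [hK, quotientSeries_ofList_const hKhom hregK, List.length_map, hlen']
  have hqI : quotientSeries I =
      quotientSeries (⊥ : Ideal (S n)) * ∏ i, (1 - PowerSeries.X ^ e i) := by
    rw [← hofFn, quotientSeries_ofList (fun x hx => (hG x hx).2) hreg.toIsWeaklyRegular,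
      List.map_ofFn, List.prod_ofFn]
    simp [hgδ]
  refine ⟨m, hm.symm, hqI, ?_⟩
  have hqJ := quotientSeries_sup_span (isGraded_ofList fun x hx => ⟨_, hKhom x hx⟩)
    (momentComb_isHomogeneous hf c)
  rw [← hK, ← hJK, hcolon] at hqJ
  have hqC : quotientSeries (K.colon (I : Set (S n))) =
      quotientSeries K - PowerSeries.X ^ m * quotientSeries I := by
    rw [← hQ, quotientSeries, quotientSeries]
    ring
  rw [hqJ, hqC, hqK]
  ring

end MilnorLogConcave
end
-- The theorem
open MilnorLogConcave in
theorem proposition1p5 (n d : ℕ) (hd : 1 ≤ d)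
    (f : S n) (hf : f.IsHomogeneous d) (hiso : HasIsolatedSingularities f)
    (e : Fin n → ℕ) (hci : IsCompleteIntersection (saturation (jacobianIdeal f)) e)
    (fs : S n) (hfs : fs.IsHomogeneous d) (hsmooth : IsSmoothHypersurface fs) :
    (∑ i, e i ≤ (n + 1) * (d - 1)) ∧
    ∃ P : Polynomial ℝ,
      (P : PowerSeries ℝ) =
        hilbertPoincare (milnorPiece fs) - hilbertPoincare (localCohomologyPiece f) ∧
      P = (∏ i, geomPoly (e i)) * geomPoly ((n + 1) * (d - 1) - ∑ i, e i) ∧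
      LogConcavePoly P ∧ UnimodalPoly P := by
  obtain ⟨m, hm, hqI, hqJ⟩ := quotientSeries_of_saturation (fun i => hf.pderiv (i := i)) hci
  have hexp : (n + 1) * (d - 1) - ∑ i, e i = (d - 1) + m := by
    rw [add_mul, one_mul, mul_comm n, ← hm]
    omega
  obtain ⟨hlc, hnn⟩ := coeffInt_prod_geomPoly Finset.univ e
  have hlc' : StronglyLogConcave (coeffInt ((∏ i, geomPoly (e i)) * geomPoly (d - 1 + m))) := by
    rw [coeffInt_mul_geomPoly]
    exact hlc.windowSum _
  refine ⟨by rw [add_mul, one_mul, mul_comm n, ← hm]; omega,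
    (∏ i, geomPoly (e i)) * geomPoly (d - 1 + m), ?_, by rw [hexp], hlc'.logConcavePoly,
    hlc'.unimodalPoly (coeffInt_nonneg_mul_geomPoly hnn _)⟩
  have hprod : (((∏ i, geomPoly (e i) : Polynomial ℝ)) : PowerSeries ℝ) *
      (1 - PowerSeries.X) ^ n = ∏ i, (1 - PowerSeries.X ^ e i) := by
    rw [← Polynomial.coeToPowerSeries.ringHom_apply, map_prod]
    simp only [Polynomial.coeToPowerSeries.ringHom_apply, ← coe_geomPoly_mul,
      Finset.prod_mul_distrib]
    simp
  have hN : hilbertPoincare (localCohomologyPiece f) =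
      quotientSeries (jacobianIdeal f) - quotientSeries (saturation (jacobianIdeal f)) := by
    rw [hilbertPoincare_localCohomologyPiece, quotientSeries, quotientSeries]
    ring
  have hJ : quotientSeries (jacobianIdeal f) = _ := hqJ
  have hI : quotientSeries (saturation (jacobianIdeal f)) = _ := hqI
  have hJ' := hJ
  rw [hqI, ← hprod] at hJ'
  rw [hN, hilbertPoincare_milnorPiece, quotientSeries_jacobianIdeal_of_isSmooth hd hfs hsmooth,
    hJ', hI, ← hprod, Polynomial.coe_mul]
  have h1 := quotientSeries_bot_mul (n := n)
  have h2 := coe_geomPoly_mul (d - 1 + m)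
  rw [pow_succ] at h1
  set H := quotientSeries (⊥ : Ideal (S n))
  -- The terms in (1 - t^(d-1))^(n+1) cancel, leaving (1 - t^(d-1+m)) H(S/I). The factors 1 - t are
  -- removed by H(S)(1 - t)^(n+1) = 1.
  linear_combination
    -(((∏ i, geomPoly (e i) : Polynomial ℝ)) : PowerSeries ℝ) *
        ((geomPoly (d - 1 + m) : Polynomial ℝ) : PowerSeries ℝ) * h1 +
      H * (((∏ i, geomPoly (e i) : Polynomial ℝ)) : PowerSeries ℝ) *
        (1 - PowerSeries.X) ^ n * h2
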